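/- For each $n=0,1,2,\dots$ let $(p_{ij}(n))_{i,j\in\{0,1\}}$ be a probability distribution on $\{0,1\}^2$, with marginals $p_{0+}=p_{00}+p_{01}$, $p_{1+}=p_{10}+p_{11}$, $p_{+0}=p_{00}+p_{10}$, $p_{+1}=p_{01}+p_{11}$, where $p_{1+}(n),p_{+1}(n)>0$. Let $\{(\xi_i(n),\eta_i(n)):\ i\ge 1,\ n\ge 0\}$ be random vectors, independent with respect to both indices, such that $(\xi_i(n),\eta_i(n))$ has the bivariate geometric distribution with parameters $p_{ij}=p_{ij}(n)$, that is, for integers $l,k\ge 0$, \[ P(\xi=l,\eta=k)=\begin{cases} p_{00}^{\,l}\,p_{10}\,p_{+0}^{\,k-l-1}\,p_{+1}, & l<k,\\ p_{00}^{\,l}\,p_{11}, & l=k,\\ p_{00}^{\,k}\,p_{01}\,p_{0+}^{\,l-k-1}\,p_{1+}, & k<l\end{cases} \] (the numbers of zeros before the first $1$ in the two coordinates of an i.i.d. sequence with law $(p_{ij})$). Let $L(x,y)=x\min\{1,y\}$ (promiscuous mating), and let $\{Z_n\}$ be the bisexual branching process given by $Z_0=N$ with an integer $N>0$ and \[ (Z^F_{n+1},Z^M_{n+1})=\sum_{i=1}^{Z_n}(\xi_i(n),\eta_i(n)),\qquad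 Z_{n+1}=L(Z^F_{n+1},Z^M_{n+1})\qquad(n\ge 0). \] Let $r_{nj}=j^{-1}E(Z_{n+1}\mid Z_n=j)=j^{-1}E\,L\big(\sum_{i=1}^j\xi_i(n),\sum_{i=1}^j\eta_i(n)\big)$ for $j\ge 1$, and $\mu_0=1$, $\mu_n=\prod_{i=0}^{n-1}r_{i1}$ for $n\ge 1$, and suppose that $\mu_n\ne 0$ for all $n$, so that the quotients $Z_n/\mu_n$ are defined. If \[ \prod_{j=1}^\infty p_{+0}(j)\,p_{0+}(j)\neq 0\qquad\text{and}\qquad \sum_{n=0}^\infty p_{+1}(n)<\infty, \] then there is a nonnegative random variable $W$ with $E(W)<\infty$ and $P(W>0)>0$ such that $\lim_{n\to\infty} Z_n/\mu_n=W$ almost surely. -/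

import Mathlib

open MeasureTheory ProbabilityTheory Filter Topology

/-- The law of a random vector `(U, V)` with values in `{0,1}²`:
`pij = P(U = i, V = j)`. -/
structure BernoulliPair where
  p00 : ℝ
  p01 : ℝ
  p10 : ℝ
  p11 : ℝ
  p00_nonneg : 0 ≤ p00
  p01_nonneg : 0 ≤ p01
  p10_nonneg : 0 ≤ p10
  p11_nonneg : 0 ≤ p11
  sum_eq_one : p00 + p01 + p10 + p11 = 1

namespace BernoulliPair

/-- `p_{0+} = P(U = 0)`. -/
def p0plus (p : BernoulliPair) : ℝ := p.p00 + p.p01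

/-- `p_{1+} = P(U = 1)`. -/
def p1plus (p : BernoulliPair) : ℝ := p.p10 + p.p11

/-- `p_{+0} = P(V = 0)`. -/
def pplus0 (p : BernoulliPair) : ℝ := p.p00 + p.p10

/-- `p_{+1} = P(V = 1)`. -/
def pplus1 (p : BernoulliPair) : ℝ := p.p01 + p.p11

/-- Probability mass at `(l, k)` of the bivariate geometric law: the numbers of zeros preceding
the first `1` in `U₁, U₂, …` and in `V₁, V₂, …`, where the `(Uₘ, Vₘ)` are independent copies of
`(U, V)`. -/
noncomputable def geomMass (p : BernoulliPair) (l k : ℕ) : ℝ :=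
  if l < k then p.p00 ^ l * p.p10 * p.pplus0 ^ (k - l - 1) * p.pplus1
  else if l = k then p.p00 ^ l * p.p11
  else p.p00 ^ k * p.p01 * p.p0plus ^ (l - k - 1) * p.p1plus

end BernoulliPair

/-- The random vector `(X, Y)` has the bivariate geometric distribution with parameter `p`. -/
def IsBivariateGeometric {Ω : Type*} [MeasurableSpace Ω] (P : Measure Ω) (p : BernoulliPair)
    (X Y : Ω → ℕ) : Prop :=
  Measurable X ∧ Measurable Y ∧
    ∀ l k : ℕ, P.real {ω | X ω = l ∧ Y ω = k} = p.geomMass l k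

/-- An array of random vectors `(ξ n i, η n i)` (generation `n`, mating unit `i`), independent with
respect to both indices, those of generation `n` being bivariate geometric with parameter `p n`. -/
def IsGeometricEnvironment {Ω : Type*} [MeasurableSpace Ω] (P : Measure Ω) (p : ℕ → BernoulliPair)
    (ξ η : ℕ → ℕ → Ω → ℕ) : Prop :=
  (∀ n i : ℕ, IsBivariateGeometric P (p n) (ξ n i) (η n i)) ∧
    iIndepFun (fun (a : ℕ × ℕ) (ω : Ω) => (ξ a.1 a.2 ω, η a.1 a.2 ω)) P

/-- The bisexual branching process with mating function `L`, `N` initial mating units and offspring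
array `(ξ n i, η n i)` of (females, males): the number of mating units in each generation. -/
def bisexualProcess {Ω : Type*} (L : ℕ → ℕ → ℕ) (N : ℕ) (ξ η : ℕ → ℕ → Ω → ℕ) : ℕ → Ω → ℕ
  | 0, _ => N
  | n + 1, ω =>
      L (∑ i ∈ Finset.range (bisexualProcess L N ξ η n ω), ξ n i ω)
        (∑ i ∈ Finset.range (bisexualProcess L N ξ η n ω), η n i ω)

/-- The mean growth rate `r_{nj}` per mating unit in generation `n` when it has `j` mating units.
As the offspring of generation `n` are independent of the past, `E(Z_{n+1} | Z_n = j)` is the mean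
of `L` applied to the numbers of females and males produced by `j` mating units. -/
noncomputable def meanGrowthRate {Ω : Type*} [MeasurableSpace Ω] (P : Measure Ω)
    (L : ℕ → ℕ → ℕ) (ξ η : ℕ → ℕ → Ω → ℕ) (n j : ℕ) : ℝ :=
  (j : ℝ)⁻¹ *
    ∫ ω, (L (∑ i ∈ Finset.range j, ξ n i ω) (∑ i ∈ Finset.range j, η n i ω) : ℝ) ∂P

/-- `μ_n = r_{01} r_{11} ⋯ r_{n-1,1}`, with `μ_0 = 1`. -/
noncomputable def normalization {Ω : Type*} [MeasurableSpace Ω] (P : Measure Ω)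
    (L : ℕ → ℕ → ℕ) (ξ η : ℕ → ℕ → Ω → ℕ) (n : ℕ) : ℝ :=
  ∏ i ∈ Finset.range n, meanGrowthRate P L ξ η i 1

/-- Promiscuous mating: `L(x, y) = x · min{1, y}`. -/
def promiscuous (x y : ℕ) : ℕ := x * min 1 y

/-! Write `m_n = p0+(n)/p1+(n)` for the mean number of females per unit and `M_n = m_0 ⋯ m_{n-1}`. A
unit alone has mean `r_{n1} = p00/p1+`: the mean number of females, less the part `p01/p1+` carried
by the event that no male is born.

Promiscuous mating is superadditive, so `j` units have mean at least `j r_{n1}`, and `Z_n/μ_n` is a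
nonnegative submartingale with initial mean `N`. It remains to bound it in `L²`. Dropping the males
can only enlarge the process, and it gives `E Z_{n+1}² ≤ m_n² E Z_n² + (m_n² + m_n) E Z_n`. Dividing
by `M_{n+1}²` and iterating bounds `E Z_n²/M_n²` by `N² + N ∑ (1/M_k + 1/M_{k+1})`. The product
condition forces `p0+(n) → 1`, hence `m_n → ∞` and the series converges
(`exists_integral_process_sq_le`). Finally `M_n ≤ D μ_n`, because `m_n/r_{n1} = 1 + p01/p00` and `∑
p01/p00` converges with `∑ p+1` (`exists_prod_mean_le`).

An `L²`-bounded submartingale converges almost surely, and uniform integrability keeps the limit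
from vanishing (`exists_limit_of_submartingale_of_sq_bounded`). -/

open scoped ENNReal

/-! ### Series for the bivariate geometric law -/

namespace BernoulliPair

variable (p : BernoulliPair)

lemma p0plus_nonneg : 0 ≤ p.p0plus := add_nonneg p.p00_nonneg p.p01_nonneg

lemma p1plus_nonneg : 0 ≤ p.p1plus := add_nonneg p.p10_nonneg p.p11_nonneg

lemma pplus0_nonneg : 0 ≤ p.pplus0 := add_nonneg p.p00_nonneg p.p10_nonneg

lemma pplus1_nonneg : 0 ≤ p.pplus1 := add_nonneg p.p01_nonneg p.p11_nonneg

lemma p0plus_add_p1plus : p.p0plus + p.p1plus = 1 := by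
  have := p.sum_eq_one
  simp only [p0plus, p1plus]
  linarith

lemma pplus0_add_pplus1 : p.pplus0 + p.pplus1 = 1 := by
  have := p.sum_eq_one
  simp only [pplus0, pplus1]
  linarith

lemma geomMass_nonneg (l k : ℕ) : 0 ≤ p.geomMass l k := by
  have h0 := p.p00_nonneg
  have h1 := p.p01_nonneg
  have h2 := p.p10_nonneg
  have h3 := p.p11_nonneg
  have h4 := p.p0plus_nonneg
  have h5 := p.p1plus_nonneg
  have h6 := p.pplus0_nonneg
  have h7 := p.pplus1_nonneg
  unfold geomMass
  split_ifs <;> positivity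

lemma geomMass_eq_zero_of_pplus1_eq_zero (h : p.pplus1 = 0) (l k : ℕ) : p.geomMass l k = 0 := by
  have h1 := p.p01_nonneg
  have h3 := p.p11_nonneg
  have h' := h
  simp only [pplus1] at h'
  have e1 : p.p01 = 0 := by linarith
  have e3 : p.p11 = 0 := by linarith
  simp [geomMass, h, e1, e3]

lemma geomMass_eq_zero_of_p1plus_eq_zero (h : p.p1plus = 0) (l k : ℕ) : p.geomMass l k = 0 := by
  have h1 := p.p10_nonneg
  have h3 := p.p11_nonneg
  have h' := h
  simp only [p1plus] at h'
  have e1 : p.p10 = 0 := by linarith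
  have e3 : p.p11 = 0 := by linarith
  simp [geomMass, h, e1, e3]

/-- The first marginal of the bivariate geometric law is geometric. -/
lemma hasSum_geomMass (h : 0 < p.pplus1) (l : ℕ) :
    HasSum (fun k => p.geomMass l k) (p.p0plus ^ l * p.p1plus) := by
  have hs := p.pplus0_add_pplus1
  have htail : HasSum (fun i => p.geomMass l (i + (l + 1))) (p.p00 ^ l * p.p10) := by
    have hg := (hasSum_geometric_of_lt_one p.pplus0_nonneg (by linarith : p.pplus0 < 1)).mul_left
      (p.p00 ^ l * p.p10 * p.pplus1)
    have e : 1 - p.pplus0 = p.pplus1 := by linarith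
    rw [e, mul_inv_cancel_right₀ h.ne'] at hg
    refine hg.congr_fun fun i => ?_
    have h1 : l < i + (l + 1) := by omega
    have h2 : i + (l + 1) - l - 1 = i := by omega
    rw [geomMass, if_pos h1, h2]
    ring
  have hinit : ∑ k ∈ Finset.range (l + 1), p.geomMass l k =
      p.p1plus * (p.p0plus ^ l - p.p00 ^ l) + p.p00 ^ l * p.p11 := by
    rw [Finset.sum_range_succ]
    congr 1
    -- As `p01 = p0+ - p00`, the sum of `p01 * p00^k * p0+^(l-1-k)` over `k < l` telescopes to
    -- `p0+^l - p00^l`.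
    · have hg := geom_sum₂_mul p.p00 p.p0plus l
      have e : p.p00 - p.p0plus = -p.p01 := by simp [p0plus]
      rw [e] at hg
      have : ∀ k ∈ Finset.range l, p.geomMass l k =
          p.p1plus * p.p01 * (p.p00 ^ k * p.p0plus ^ (l - 1 - k)) := by
        intro k hk
        have hk := Finset.mem_range.1 hk
        have h2 : l - k - 1 = l - 1 - k := by omega
        rw [geomMass, if_neg (by omega), if_neg (by omega), h2]
        ring
      rw [Finset.sum_congr rfl this, ← Finset.mul_sum]
      linear_combination -p.p1plus * hg
    · simp [geomMass]
  have := (hasSum_nat_add_iff (f := fun k => p.geomMass l k) (l + 1)).1 htail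
  rw [hinit] at this
  convert! this using 1
  simp only [p1plus]
  ring

lemma hasSum_mul_geom (h : 0 < p.p1plus) :
    HasSum (fun l : ℕ => (l : ℝ) * (p.p0plus ^ l * p.p1plus)) (p.p0plus / p.p1plus) := by
  have hs := p.p0plus_add_p1plus
  have hq : ‖p.p0plus‖ < 1 := by
    rw [Real.norm_of_nonneg p.p0plus_nonneg]; linarith
  have hg := (hasSum_coe_mul_geometric_of_norm_lt_one hq).mul_right p.p1plus
  have e : 1 - p.p0plus = p.p1plus := by linarith
  rw [e] at hg
  convert! hg using 1
  · ext l; ring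
  · field_simp

lemma hasSum_sq_mul_geom (h : 0 < p.p1plus) :
    HasSum (fun l : ℕ => (l : ℝ) ^ 2 * (p.p0plus ^ l * p.p1plus))
      ((p.p0plus / p.p1plus) ^ 2 + ((p.p0plus / p.p1plus) ^ 2 + p.p0plus / p.p1plus)) := by
  have hs := p.p0plus_add_p1plus
  have hq : ‖p.p0plus‖ < 1 := by
    rw [Real.norm_of_nonneg p.p0plus_nonneg]; linarith
  have g0 := hasSum_geometric_of_norm_lt_one hq
  have g1 := hasSum_coe_mul_geometric_of_norm_lt_one hq
  have g2 := hasSum_choose_mul_geometric_of_norm_lt_one 2 hq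
  have e : 1 - p.p0plus = p.p1plus := by linarith
  rw [e] at g0 g1 g2
  -- `l² = 2 * (l+2 choose 2) - 3l - 2`.
  convert! (((g2.mul_left 2).sub (g1.mul_left 3)).sub (g0.mul_left 2)).mul_right p.p1plus using 1
  · ext l
    rw [Nat.cast_choose_two]
    push_cast
    ring
  · field_simp
    rw [← e]
    ring

/-- This is the mean number of females lost for want of a male. The term `l = 0` vanishes, and the
shifted series is a multiple of `∑ (l+1) q^l = 1/(1-q)²`. -/
lemma hasSum_mul_geomMass_zero (h : 0 < p.p1plus) :
    HasSum (fun l : ℕ => (l : ℝ) * p.geomMass l 0) (p.p01 / p.p1plus) := by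
  have hs := p.p0plus_add_p1plus
  have hq : ‖p.p0plus‖ < 1 := by
    rw [Real.norm_of_nonneg p.p0plus_nonneg]; linarith
  have g1 := (hasSum_choose_mul_geometric_of_norm_lt_one 1 hq).mul_left (p.p01 * p.p1plus)
  have e : 1 - p.p0plus = p.p1plus := by linarith
  rw [e] at g1
  have h1 : HasSum (fun l : ℕ => ((l + 1 : ℕ) : ℝ) * p.geomMass (l + 1) 0)
      (p.p01 / p.p1plus) := by
    convert! g1 using 1
    · ext l
      simp [geomMass]
      ring
    · field_simp
  have := (hasSum_nat_add_iff (f := fun l : ℕ => (l : ℝ) * p.geomMass l 0) 1).1 h1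
  simpa using this

end BernoulliPair

/-! ### Moments of one offspring vector -/

section Moments

variable {Ω : Type*} [MeasurableSpace Ω] {P : Measure Ω}

lemma lintegral_comp_nat {X : Ω → ℕ} (hX : Measurable X) (f : ℕ → ℝ≥0∞) :
    ∫⁻ ω, f (X ω) ∂P = ∑' l, f l * P {ω | X ω = l} := by
  rw [← lintegral_map (measurable_of_countable f) hX, lintegral_countable']
  refine tsum_congr fun l => ?_
  rw [Measure.map_apply hX (measurableSet_singleton l)]
  rfl

lemma tsum_ofReal_of_hasSum {f : ℕ → ℝ} {a : ℝ} (hf : ∀ n, 0 ≤ f n) (h : HasSum f a) :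
    ∑' n, ENNReal.ofReal (f n) = ENNReal.ofReal a := by
  rw [← ENNReal.ofReal_tsum_of_nonneg hf h.summable, h.tsum_eq]

namespace IsBivariateGeometric

variable [IsProbabilityMeasure P] {p : BernoulliPair} {X Y : Ω → ℕ}

lemma measure_eq (h : IsBivariateGeometric P p X Y) (l k : ℕ) :
    P {ω | X ω = l ∧ Y ω = k} = ENNReal.ofReal (p.geomMass l k) := by
  rw [← h.2.2 l k, ofReal_measureReal]

lemma measure_fst_eq_tsum (h : IsBivariateGeometric P p X Y) (l : ℕ) :
    P {ω | X ω = l} = ∑' k, ENNReal.ofReal (p.geomMass l k) := by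
  have hm : MeasurableSet {ω | X ω = l} := h.1 (measurableSet_singleton l)
  -- The total mass of `P` restricted to `X = l` is split along the values of `Y`.
  have := lintegral_comp_nat (P := P.restrict {ω | X ω = l}) h.2.1 (fun _ => 1)
  rw [lintegral_one, Measure.restrict_apply_univ] at this
  rw [this]
  refine tsum_congr fun k => ?_
  rw [one_mul,
    Measure.restrict_apply (show MeasurableSet {ω | Y ω = k} from h.2.1 (measurableSet_singleton k)),
    ← h.measure_eq]
  congr 1
  ext ω
  simp [and_comm]

/-- Otherwise the law of the vector would have total mass zero. Positivity of `p+1` and `p1+`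
follows, since all masses vanish when either of them does. -/
lemma exists_geomMass_ne_zero (h : IsBivariateGeometric P p X Y) :
    ∃ l k, p.geomMass l k ≠ 0 := by
  by_contra! h0
  have := lintegral_comp_nat (P := P) h.1 (fun _ => 1)
  simp [h.measure_fst_eq_tsum, h0] at this

lemma pplus1_pos (h : IsBivariateGeometric P p X Y) : 0 < p.pplus1 := by
  obtain ⟨l, k, hlk⟩ := h.exists_geomMass_ne_zero
  exact p.pplus1_nonneg.lt_of_ne'
    fun h0 => hlk (p.geomMass_eq_zero_of_pplus1_eq_zero h0 l k)

lemma p1plus_pos (h : IsBivariateGeometric P p X Y) : 0 < p.p1plus := by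
  obtain ⟨l, k, hlk⟩ := h.exists_geomMass_ne_zero
  exact p.p1plus_nonneg.lt_of_ne'
    fun h0 => hlk (p.geomMass_eq_zero_of_p1plus_eq_zero h0 l k)

lemma measure_fst (h : IsBivariateGeometric P p X Y) (l : ℕ) :
    P {ω | X ω = l} = ENNReal.ofReal (p.p0plus ^ l * p.p1plus) := by
  rw [h.measure_fst_eq_tsum,
    tsum_ofReal_of_hasSum (p.geomMass_nonneg l) (p.hasSum_geomMass h.pplus1_pos l)]

lemma lintegral_fst (h : IsBivariateGeometric P p X Y) :
    ∫⁻ ω, (X ω : ℝ≥0∞) ∂P = ENNReal.ofReal (p.p0plus / p.p1plus) := by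
  have hp := h.p1plus_pos
  have h0 := p.p0plus_nonneg
  rw [lintegral_comp_nat h.1 (fun l => (l : ℝ≥0∞)),
    ← tsum_ofReal_of_hasSum (fun n => by positivity) (p.hasSum_mul_geom hp)]
  refine tsum_congr fun l => ?_
  rw [h.measure_fst, ENNReal.ofReal_mul (Nat.cast_nonneg l), ENNReal.ofReal_natCast]

lemma lintegral_fst_sq (h : IsBivariateGeometric P p X Y) :
    ∫⁻ ω, (X ω : ℝ≥0∞) ^ 2 ∂P = ENNReal.ofReal
      ((p.p0plus / p.p1plus) ^ 2 + ((p.p0plus / p.p1plus) ^ 2 + p.p0plus / p.p1plus)) := by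
  have hp := h.p1plus_pos
  have h0 := p.p0plus_nonneg
  rw [lintegral_comp_nat h.1 (fun l => (l : ℝ≥0∞) ^ 2),
    ← tsum_ofReal_of_hasSum (fun n => by positivity) (p.hasSum_sq_mul_geom hp)]
  refine tsum_congr fun l => ?_
  rw [h.measure_fst, ENNReal.ofReal_mul (sq_nonneg (l : ℝ)),
    ENNReal.ofReal_pow (Nat.cast_nonneg l), ENNReal.ofReal_natCast]

lemma setLIntegral_fst (h : IsBivariateGeometric P p X Y) :
    ∫⁻ ω in {ω | Y ω = 0}, (X ω : ℝ≥0∞) ∂P = ENNReal.ofReal (p.p01 / p.p1plus) := by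
  have hp := h.p1plus_pos
  rw [lintegral_comp_nat h.1 (fun l => (l : ℝ≥0∞)),
    ← tsum_ofReal_of_hasSum (fun n => mul_nonneg (Nat.cast_nonneg n) (p.geomMass_nonneg n 0))
      (p.hasSum_mul_geomMass_zero hp)]
  refine tsum_congr fun l => ?_
  rw [Measure.restrict_apply (show MeasurableSet {ω | X ω = l} from h.1 (measurableSet_singleton l)),
    ENNReal.ofReal_mul (Nat.cast_nonneg l), ENNReal.ofReal_natCast, ← h.measure_eq]
  rfl

/-- Off `Y = 0` the mating function equals `X`, on `Y = 0` it is zero; so the mean is `p0+/p1+ -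
p01/p1+`, obtained by cancelling a finite term. -/
lemma lintegral_promiscuous (h : IsBivariateGeometric P p X Y) :
    ∫⁻ ω, (promiscuous (X ω) (Y ω) : ℝ≥0∞) ∂P = ENNReal.ofReal (p.p00 / p.p1plus) := by
  have hp := h.p1plus_pos
  have hm : MeasurableSet {ω | Y ω = 0} := h.2.1 (measurableSet_singleton 0)
  have h1 := lintegral_add_compl (μ := P) (fun ω => (X ω : ℝ≥0∞)) hm
  have h2 := lintegral_add_compl (μ := P) (fun ω => (promiscuous (X ω) (Y ω) : ℝ≥0∞)) hm
  have e1 : ∫⁻ ω in {ω | Y ω = 0}, (promiscuous (X ω) (Y ω) : ℝ≥0∞) ∂P = 0 := by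
    rw [setLIntegral_congr_fun hm (g := fun _ => 0), lintegral_zero]
    intro ω hω
    have hω : Y ω = 0 := hω
    simp [promiscuous, hω]
  have e2 : ∫⁻ ω in {ω | Y ω = 0}ᶜ, (promiscuous (X ω) (Y ω) : ℝ≥0∞) ∂P =
      ∫⁻ ω in {ω | Y ω = 0}ᶜ, (X ω : ℝ≥0∞) ∂P := by
    refine setLIntegral_congr_fun hm.compl fun ω hω => ?_
    have hω : Y ω ≠ 0 := hω
    have : min 1 (Y ω) = 1 := by omega
    simp [promiscuous, this]
  rw [e1, zero_add, e2] at h2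
  rw [← h2]
  rw [h.setLIntegral_fst, h.lintegral_fst] at h1
  have e3 : p.p0plus / p.p1plus = p.p01 / p.p1plus + p.p00 / p.p1plus := by
    rw [← add_div, BernoulliPair.p0plus, add_comm]
  rw [e3, ENNReal.ofReal_add (div_nonneg p.p01_nonneg hp.le) (div_nonneg p.p00_nonneg hp.le)] at h1
  exact (ENNReal.add_right_inj ENNReal.ofReal_ne_top).1 h1

end IsBivariateGeometric

end Moments

/-! ### Bounds for the mating function -/

/-- One male anywhere lets all females mate, whereas separate units also lose the females of the
units without a male. -/
lemma promiscuous_superadditive {ι : Type*} (s : Finset ι) (x y : ι → ℕ) :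
    ∑ i ∈ s, promiscuous (x i) (y i) ≤ promiscuous (∑ i ∈ s, x i) (∑ i ∈ s, y i) := by
  rcases Nat.eq_zero_or_pos (∑ i ∈ s, y i) with h0 | h0
  · refine (Finset.sum_eq_zero fun i hi => ?_).trans_le (Nat.zero_le _)
    simp [promiscuous, Finset.sum_eq_zero_iff.1 h0 i hi]
  · have : min 1 (∑ i ∈ s, y i) = 1 := by omega
    rw [promiscuous, this, mul_one]
    exact Finset.sum_le_sum fun i _ =>
      (Nat.mul_le_mul_left _ (min_le_left _ _)).trans_eq (mul_one _)

lemma promiscuous_le (x y : ℕ) : promiscuous x y ≤ x :=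
  (Nat.mul_le_mul_left _ (min_le_left _ _)).trans_eq (mul_one _)

/-! ### Integration over an independent random index -/

section RandomIndex

variable {Ω : Type*}

lemma measurable_nat_cast_ennreal {m : MeasurableSpace Ω} {X : Ω → ℕ} (hX : Measurable X) :
    Measurable fun ω => (X ω : ℝ≥0∞) :=
  (measurable_of_countable fun k : ℕ => (k : ℝ≥0∞)).comp hX

lemma measurable_comp_nat {m : MeasurableSpace Ω} {β : Type*} [MeasurableSpace β] {T : Ω → ℕ}
    {g : ℕ → Ω → β} (hT : Measurable[m] T) (hg : ∀ j, Measurable[m] (g j)) :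
    Measurable[m] fun ω => g (T ω) ω :=
  (measurable_from_prod_countable_right (f := fun x : ℕ × Ω => g x.1 x.2) hg).comp
    (hT.prodMk measurable_id)

/-- If the random index `T` is independent of the family `g`, then `g (T ·)` may be replaced by
its mean over `g` under the integral. -/
lemma setLIntegral_random_index {m₁ m₂ mΩ : MeasurableSpace Ω} {P : Measure Ω} (h₁ : m₁ ≤ mΩ) (h₂ : m₂ ≤ mΩ)
    (hind : Indep m₁ m₂ P) {T : Ω → ℕ} (hT : Measurable[m₁] T) {A : Set Ω}
    (hA : MeasurableSet[m₁] A) {g : ℕ → Ω → ℝ≥0∞} (hg : ∀ j, Measurable[m₂] (g j)) :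
    ∫⁻ ω in A, g (T ω) ω ∂P = ∫⁻ ω in A, ∫⁻ ω', g (T ω) ω' ∂P ∂P := by
  have hS : ∀ j, MeasurableSet[m₁] (A ∩ T ⁻¹' {j}) := fun j =>
    hA.inter (hT (measurableSet_singleton j))
  -- The decomposition along the values of `T` is stated for any family `f`, to be used both for `g`
  -- and for the constant means of `g`; independence then identifies the two series term by term.
  have key : ∀ f : ℕ → Ω → ℝ≥0∞, (∀ j, Measurable[mΩ] (f j)) →
      ∫⁻ ω in A, f (T ω) ω ∂P =
        ∑' j, ∫⁻ ω, (A ∩ T ⁻¹' {j}).indicator (fun _ => 1) ω * f j ω ∂P := by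
    intro f hf
    rw [← lintegral_indicator (h₁ _ hA), ← lintegral_tsum]
    · refine lintegral_congr fun ω => ?_
      rw [tsum_eq_single (T ω)]
      · by_cases hω : ω ∈ A <;> simp [hω]
      · intro j hj
        simp [Ne.symm hj]
    · intro j
      exact ((measurable_const.indicator (h₁ _ (hS j))).mul (hf j)).aemeasurable
  rw [key g fun j => (hg j).mono h₂ le_rfl,
    key (fun j _ => ∫⁻ ω', g j ω' ∂P) fun j => measurable_const]
  refine tsum_congr fun j => ?_
  have hmeas : Measurable[m₁] ((A ∩ T ⁻¹' {j}).indicator (fun _ => (1 : ℝ≥0∞))) :=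
    Measurable.indicator measurable_const (hS j)
  rw [lintegral_mul_eq_lintegral_mul_lintegral_of_independent_measurableSpace h₁ h₂ hind
    hmeas (hg j), lintegral_mul_const _ (hmeas.mono h₁ le_rfl)]

end RandomIndex

/-! ### Markov property and moments of one generation -/

section OffspringArray

variable {Ω : Type*}

/-- The σ-algebra generated by the offspring vectors of the generations in `S`. -/
@[reducible]
def generationSigma (ξ η : ℕ → ℕ → Ω → ℕ) (S : Set ℕ) : MeasurableSpace Ω :=
  ⨆ a ∈ {a : ℕ × ℕ | a.1 ∈ S}, MeasurableSpace.comap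
    (fun ω => (ξ a.1 a.2 ω, η a.1 a.2 ω)) inferInstance

variable {ξ η : ℕ → ℕ → Ω → ℕ}

lemma generationSigma_mono {S T : Set ℕ} (h : S ⊆ T) :
    generationSigma ξ η S ≤ generationSigma ξ η T :=
  biSup_mono fun _ ha => h ha

lemma measurable_offspring_generationSigma {S : Set ℕ} {n : ℕ} (hn : n ∈ S) (i : ℕ) :
    Measurable[generationSigma ξ η S] fun ω => (ξ n i ω, η n i ω) := by
  refine Measurable.of_comap_le ?_
  exact le_biSup (fun a : ℕ × ℕ => MeasurableSpace.comap
    (fun ω => (ξ a.1 a.2 ω, η a.1 a.2 ω)) inferInstance) (show (n, i) ∈ {a : ℕ × ℕ | a.1 ∈ S} from hn)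

lemma measurable_mating_generationSigma (L : ℕ → ℕ → ℕ) {S : Set ℕ} {n : ℕ} (hn : n ∈ S) (j : ℕ) :
    Measurable[generationSigma ξ η S] fun ω =>
      L (∑ i ∈ Finset.range j, ξ n i ω) (∑ i ∈ Finset.range j, η n i ω) := by
  have h := measurable_offspring_generationSigma (ξ := ξ) (η := η) hn
  have h1 : Measurable[generationSigma ξ η S] fun ω => ∑ i ∈ Finset.range j, ξ n i ω :=
    Finset.measurable_fun_sum _ fun i _ => measurable_fst.comp (h i)
  have h2 : Measurable[generationSigma ξ η S] fun ω => ∑ i ∈ Finset.range j, η n i ω :=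
    Finset.measurable_fun_sum _ fun i _ => measurable_snd.comp (h i)
  exact (measurable_of_countable fun x : ℕ × ℕ => L x.1 x.2).comp (h1.prodMk h2)

lemma measurable_bisexualProcess (L : ℕ → ℕ → ℕ) (N n : ℕ) :
    Measurable[generationSigma ξ η (Set.Iio n)] (bisexualProcess L N ξ η n) := by
  induction n with
  | zero => exact measurable_const
  | succ n ih =>
    exact measurable_comp_nat
      (g := fun j ω => L (∑ i ∈ Finset.range j, ξ n i ω) (∑ i ∈ Finset.range j, η n i ω))
      (ih.mono (generationSigma_mono (Set.Iio_subset_Iio n.le_succ)) le_rfl)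
      (measurable_mating_generationSigma L (Nat.lt_succ_self n))

variable [mΩ : MeasurableSpace Ω] {P : Measure Ω} {p : ℕ → BernoulliPair}

namespace IsGeometricEnvironment

lemma measurable_offspring (h : IsGeometricEnvironment P p ξ η) (n i : ℕ) :
    Measurable fun ω => (ξ n i ω, η n i ω) :=
  (h.1 n i).1.prodMk (h.1 n i).2.1

lemma generationSigma_le (h : IsGeometricEnvironment P p ξ η) (S : Set ℕ) :
    generationSigma ξ η S ≤ mΩ :=
  iSup₂_le fun a _ => (h.measurable_offspring a.1 a.2).comap_le

lemma indep_generationSigma (h : IsGeometricEnvironment P p ξ η) {S T : Set ℕ}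
    (hST : Disjoint S T) : Indep (generationSigma ξ η S) (generationSigma ξ η T) P :=
  indep_iSup_of_disjoint
    (m := fun a : ℕ × ℕ =>
      MeasurableSpace.comap (fun ω => (ξ a.1 a.2 ω, η a.1 a.2 ω)) inferInstance)
    (S := {a | a.1 ∈ S}) (T := {a | a.1 ∈ T})
    (fun a => (h.measurable_offspring a.1 a.2).comap_le)
    ((iIndepFun_iff_iIndep _ _ _).1 h.2)
    (Set.disjoint_left.2 fun _ ha hb => Set.disjoint_left.1 hST ha hb)

/-- The σ-algebras of the past of the process. -/
def pastFiltration (h : IsGeometricEnvironment P p ξ η) : Filtration ℕ mΩ where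
  seq n := generationSigma ξ η (Set.Iio n)
  mono' _ _ hnm := generationSigma_mono (Set.Iio_subset_Iio hnm)
  le' _ := h.generationSigma_le _

/-- The Markov property of the process, for means of functions of the next generation. -/
lemma setLIntegral_bisexualProcess_succ (h : IsGeometricEnvironment P p ξ η) (L : ℕ → ℕ → ℕ)
    (N n : ℕ) {A : Set Ω} (hA : MeasurableSet[generationSigma ξ η (Set.Iio n)] A)
    (f : ℕ → ℝ≥0∞) :
    ∫⁻ ω in A, f (bisexualProcess L N ξ η (n + 1) ω) ∂P =
      ∫⁻ ω in A, ∫⁻ ω', f (L (∑ i ∈ Finset.range (bisexualProcess L N ξ η n ω), ξ n i ω')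
        (∑ i ∈ Finset.range (bisexualProcess L N ξ η n ω), η n i ω')) ∂P ∂P :=
  setLIntegral_random_index (m₂ := generationSigma ξ η {n})
    (h.generationSigma_le _) (h.generationSigma_le _)
    (h.indep_generationSigma (by simp)) (measurable_bisexualProcess L N n) hA
    (g := fun j ω => f (L (∑ i ∈ Finset.range j, ξ n i ω) (∑ i ∈ Finset.range j, η n i ω)))
    fun j => (measurable_of_countable f).comp
      (measurable_mating_generationSigma L (Set.mem_singleton n) j)

variable [IsProbabilityMeasure P]

lemma meanGrowthRate_one (h : IsGeometricEnvironment P p ξ η) (n : ℕ) :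
    meanGrowthRate P promiscuous ξ η n 1 = (p n).p00 / (p n).p1plus := by
  have hm : Measurable fun ω => promiscuous (ξ n 0 ω) (η n 0 ω) :=
    (measurable_of_countable fun x : ℕ × ℕ => promiscuous x.1 x.2).comp
      (h.measurable_offspring n 0)
  have hl := (h.1 n 0).lintegral_promiscuous
  simp only [meanGrowthRate, Nat.cast_one, inv_one, one_mul, Finset.range_one,
    Finset.sum_singleton]
  rw [integral_eq_lintegral_of_nonneg_ae (ae_of_all _ fun ω => Nat.cast_nonneg _)
    ((measurable_of_countable fun k : ℕ => (k : ℝ)).comp hm).aestronglyMeasurable]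
  simp only [ENNReal.ofReal_natCast]
  rw [hl, ENNReal.toReal_ofReal (div_nonneg (p n).p00_nonneg (p n).p1plus_nonneg)]

lemma le_lintegral_promiscuous (h : IsGeometricEnvironment P p ξ η) (n j : ℕ) :
    j * ENNReal.ofReal ((p n).p00 / (p n).p1plus) ≤
      ∫⁻ ω, (promiscuous (∑ i ∈ Finset.range j, ξ n i ω) (∑ i ∈ Finset.range j, η n i ω) : ℝ≥0∞)
        ∂P := by
  calc _ = ∫⁻ ω, ∑ i ∈ Finset.range j, (promiscuous (ξ n i ω) (η n i ω) : ℝ≥0∞) ∂P := by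
        rw [lintegral_finsetSum]
        · simp [(h.1 n _).lintegral_promiscuous]
        · exact fun i _ => measurable_nat_cast_ennreal
            ((measurable_of_countable fun x : ℕ × ℕ => promiscuous x.1 x.2).comp
              (h.measurable_offspring n i))
    _ ≤ _ := lintegral_mono fun ω => by
        simp only [← Nat.cast_sum]
        exact Nat.mono_cast (promiscuous_superadditive _ _ _)

lemma lintegral_promiscuous_le (h : IsGeometricEnvironment P p ξ η) (n j : ℕ) :
    ∫⁻ ω, (promiscuous (∑ i ∈ Finset.range j, ξ n i ω) (∑ i ∈ Finset.range j, η n i ω) : ℝ≥0∞) ∂P ≤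
      j * ENNReal.ofReal ((p n).p0plus / (p n).p1plus) := by
  calc _ ≤ ∫⁻ ω, ∑ i ∈ Finset.range j, (ξ n i ω : ℝ≥0∞) ∂P := lintegral_mono fun ω => by
        simp only [← Nat.cast_sum]
        exact Nat.mono_cast (promiscuous_le _ _)
    _ = _ := by
        rw [lintegral_finsetSum]
        · simp [(h.1 n _).lintegral_fst]
        · exact fun i _ => measurable_nat_cast_ennreal (h.1 n i).1

/-- The squared mean, plus on the diagonal the variance `m² + m` of the geometric law. This form
makes the excess over `j² m²` in the sum over `i, k < j` linear in `j`. -/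
lemma lintegral_mul_offspring (h : IsGeometricEnvironment P p ξ η) (n i k : ℕ) :
    ∫⁻ ω, (ξ n i ω : ℝ≥0∞) * ξ n k ω ∂P ≤ ENNReal.ofReal ((p n).p0plus / (p n).p1plus) ^ 2 +
      if i = k then ENNReal.ofReal (((p n).p0plus / (p n).p1plus) ^ 2 +
        (p n).p0plus / (p n).p1plus) else 0 := by
  have hm : 0 ≤ (p n).p0plus / (p n).p1plus :=
    div_nonneg (p n).p0plus_nonneg (p n).p1plus_nonneg
  split_ifs with hik
  · subst hik
    rw [← ENNReal.ofReal_pow hm, ← ENNReal.ofReal_add (by positivity) (by positivity),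
      ← (h.1 n i).lintegral_fst_sq]
    simp [sq]
  · have hne : (n, i) ≠ (n, k) := by simp [hik]
    have hind : IndepFun (fun ω => (ξ n i ω : ℝ≥0∞)) (fun ω => (ξ n k ω : ℝ≥0∞)) P :=
      (h.2.indepFun hne).comp (φ := fun x : ℕ × ℕ => (x.1 : ℝ≥0∞))
        (ψ := fun x : ℕ × ℕ => (x.1 : ℝ≥0∞))
        (measurable_of_countable _) (measurable_of_countable _)
    refine (lintegral_mul_eq_lintegral_mul_lintegral_of_indepFun
      (measurable_nat_cast_ennreal (h.1 n i).1)
      (measurable_nat_cast_ennreal (h.1 n k).1) hind).trans_le ?_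
    rw [(h.1 n i).lintegral_fst, (h.1 n k).lintegral_fst, sq, add_zero]

lemma lintegral_promiscuous_sq_le (h : IsGeometricEnvironment P p ξ η) (n j : ℕ) :
    ∫⁻ ω, (promiscuous (∑ i ∈ Finset.range j, ξ n i ω) (∑ i ∈ Finset.range j, η n i ω) : ℝ≥0∞) ^ 2
      ∂P ≤ (j : ℝ≥0∞) ^ 2 * ENNReal.ofReal ((p n).p0plus / (p n).p1plus) ^ 2 +
        j * ENNReal.ofReal (((p n).p0plus / (p n).p1plus) ^ 2 + (p n).p0plus / (p n).p1plus) := by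
  have hmeas : ∀ i, Measurable fun ω => (ξ n i ω : ℝ≥0∞) := fun i =>
    measurable_nat_cast_ennreal (h.1 n i).1
  calc _ ≤ ∫⁻ ω, (∑ i ∈ Finset.range j, (ξ n i ω : ℝ≥0∞)) ^ 2 ∂P := lintegral_mono fun ω => by
        simp only [← Nat.cast_sum]
        exact pow_le_pow_left' (Nat.mono_cast (promiscuous_le _ _)) 2
    _ = ∑ i ∈ Finset.range j, ∑ k ∈ Finset.range j, ∫⁻ ω, (ξ n i ω : ℝ≥0∞) * ξ n k ω ∂P := by
        simp_rw [sq, Finset.sum_mul_sum]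
        rw [lintegral_finsetSum]
        · refine Finset.sum_congr rfl fun i _ => ?_
          rw [lintegral_finsetSum]
          exact fun k _ => (hmeas i).mul (hmeas k)
        · exact fun i _ => Finset.measurable_fun_sum _ fun k _ => (hmeas i).mul (hmeas k)
    _ ≤ _ := Finset.sum_le_sum fun i _ => Finset.sum_le_sum fun k _ =>
        h.lintegral_mul_offspring n i k
    _ = _ := by
        simp only [Finset.sum_add_distrib, Finset.sum_const, Finset.card_range, nsmul_eq_mul,
          Finset.sum_ite_eq]
        rw [← mul_assoc, ← sq]
        congr 1
        rw [Finset.sum_ite_of_true (fun i hi => hi)]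
        simp

end IsGeometricEnvironment

end OffspringArray

/-! ### Submartingales bounded in `L²` -/

section Limit

variable {Ω : Type*} {mΩ : MeasurableSpace Ω} {P : Measure Ω} [IsProbabilityMeasure P]

lemma sub_sq_div_le_min {x K : ℝ} (hx : 0 ≤ x) (hK : 0 < K) : x - x ^ 2 / K ≤ min x K := by
  refine le_min (by have : 0 ≤ x ^ 2 / K := by positivity
                    linarith) ?_
  rw [sub_le_iff_le_add, ← sub_le_iff_le_add', le_div_iff₀ hK]
  nlinarith [sq_nonneg (x - K), mul_nonneg hx hK.le]

/-- A nonnegative submartingale which is bounded in `L²` and has a positive initial mean converges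
almost surely to an integrable limit which is not almost surely zero. -/
theorem exists_limit_of_submartingale_of_sq_bounded {X : ℕ → Ω → ℝ} {ℱ : Filtration ℕ mΩ} {C : ℝ}
    (hX : Submartingale X ℱ P) (h0 : ∀ n ω, 0 ≤ X n ω)
    (hint : ∀ n, Integrable (fun ω => X n ω ^ 2) P) (hC : ∀ n, ∫ ω, X n ω ^ 2 ∂P ≤ C)
    (hpos : 0 < ∫ ω, X 0 ω ∂P) :
    ∃ W : Ω → ℝ, Measurable W ∧ (∀ ω, 0 ≤ W ω) ∧
      (∀ᵐ ω ∂P, Tendsto (fun n => X n ω) atTop (𝓝 (W ω))) ∧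
      Integrable W P ∧ 0 < P {ω | 0 < W ω} := by
  have hbdd : ∀ n, eLpNorm (X n) 1 P ≤ (1 + C).toNNReal := by
    intro n
    rw [eLpNorm_one_eq_lintegral_enorm, ← ofReal_integral_norm_eq_lintegral_enorm (hX.integrable n)]
    refine ENNReal.ofReal_le_ofReal ?_
    calc ∫ ω, ‖X n ω‖ ∂P ≤ ∫ ω, (1 + X n ω ^ 2) ∂P := by
          refine integral_mono (hX.integrable n).norm ((integrable_const 1).add (hint n)) fun ω => ?_
          rw [Real.norm_of_nonneg (h0 n ω)]
          -- The `L¹` bound needed for convergence comes from `x ≤ 1 + x²`.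
          nlinarith [sq_nonneg (X n ω - 1), h0 n ω]
      _ ≤ 1 + C := by
          rw [integral_add (integrable_const 1) (hint n)]
          simpa using hC n
  have hlim := hX.ae_tendsto_limitProcess hbdd
  have hmem := Filtration.memLp_limitProcess_of_eLpNorm_bdd (ℱ := ℱ)
    (fun n => (hX.integrable n).aestronglyMeasurable) hbdd
  have hmeas : Measurable (Filtration.limitProcess X ℱ P) :=
    Filtration.stronglyMeasurable_limit_process'.measurable
  have hlim' : ∀ᵐ ω ∂P, Tendsto (fun n => X n ω) atTop
      (𝓝 (max (Filtration.limitProcess X ℱ P ω) 0)) := by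
    filter_upwards [hlim] with ω hω
    rwa [max_eq_left (ge_of_tendsto' hω fun n => h0 n ω)]
  -- The positive part makes the limit nonnegative everywhere, not only almost surely.
  refine ⟨fun ω => max (Filtration.limitProcess X ℱ P ω) 0, hmeas.max measurable_const,
    fun ω => le_max_right _ _, hlim', (memLp_one_iff_integrable.1 hmem).pos_part, ?_⟩
  rw [pos_iff_ne_zero]
  intro hzero
  have hW : ∀ᵐ ω ∂P, max (Filtration.limitProcess X ℱ P ω) 0 = 0 := by
    filter_upwards [measure_eq_zero_iff_ae_notMem.1 hzero] with ω hω
    exact le_antisymm (not_lt.1 hω) (le_max_right _ _)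
  set a := ∫ ω, X 0 ω ∂P with ha
  have hC0 : 0 ≤ C := (integral_nonneg fun ω => sq_nonneg (X 0 ω)).trans (hC 0)
  -- With this level, `a - C / K = a / (C + 1) > 0`. Truncation at `K` thus keeps the means away
  -- from zero, while dominated convergence would send them to zero if the limit vanished almost
  -- surely.
  set K := (C + 1) / a with hK
  have hKpos : 0 < K := by positivity
  have hlower : ∀ n, a - C / K ≤ ∫ ω, min (X n ω) K ∂P := by
    intro n
    have hmono : a ≤ ∫ ω, X n ω ∂P := by
      have := hX.setIntegral_le (Nat.zero_le n) MeasurableSet.univ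
      simpa using this
    calc a - C / K ≤ ∫ ω, X n ω ∂P - (∫ ω, X n ω ^ 2 ∂P) / K := by
          have := div_le_div_of_nonneg_right (hC n) hKpos.le
          linarith
      _ = ∫ ω, (X n ω - X n ω ^ 2 / K) ∂P := by
          rw [integral_sub (hX.integrable n) ((hint n).div_const K), integral_div]
      _ ≤ ∫ ω, min (X n ω) K ∂P :=
          integral_mono ((hX.integrable n).sub ((hint n).div_const K))
            ((hX.integrable n).inf (integrable_const K)) fun ω => sub_sq_div_le_min (h0 n ω) hKpos
  have htend : Tendsto (fun n => ∫ ω, min (X n ω) K ∂P) atTop (𝓝 (∫ _, (0 : ℝ) ∂P)) := by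
    refine tendsto_integral_of_dominated_convergence (fun _ => K)
      (fun n => ((hX.integrable n).inf (integrable_const K)).aestronglyMeasurable)
      (integrable_const K) (fun n => ae_of_all _ fun ω => ?_) ?_
    · rw [Real.norm_of_nonneg (le_min (h0 n ω) hKpos.le)]
      exact min_le_right _ _
    · filter_upwards [hlim', hW] with ω h1 h2
      rw [h2] at h1
      simpa [hKpos.le] using h1.min (tendsto_const_nhds (x := K))
  have hfinal : a - C / K ≤ 0 := by
    simpa using ge_of_tendsto' htend hlower
  have : a - C / K = a / (C + 1) := by
    rw [hK]
    field_simp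
    ring
  rw [this] at hfinal
  exact absurd hfinal (not_le.2 (by positivity))

end Limit

/-! ### Consequences of the conditions on the environment -/

section Environment

variable {p : ℕ → BernoulliPair}

lemma BernoulliPair.p0plus_le_one (q : BernoulliPair) : q.p0plus ≤ 1 := by
  linarith [q.p0plus_add_p1plus, q.p1plus_nonneg]

lemma BernoulliPair.pplus0_le_one (q : BernoulliPair) : q.pplus0 ≤ 1 := by
  linarith [q.pplus0_add_pplus1, q.pplus1_nonneg]

lemma tendsto_one_of_tendsto_prod_Icc {f : ℕ → ℝ} {a : ℝ} (ha : a ≠ 0)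
    (h : Tendsto (fun n => ∏ j ∈ Finset.Icc 1 n, f j) atTop (𝓝 a)) :
    Tendsto f atTop (𝓝 1) := by
  have h1 := (h.comp (tendsto_add_atTop_nat 1)).div h ha
  rw [div_self ha] at h1
  refine (tendsto_add_atTop_iff_nat 1).1 (h1.congr' ?_)
  filter_upwards [h.eventually_ne ha] with n hn
  simp only [Function.comp, Pi.div_apply]
  rw [← Nat.succ_eq_add_one, Finset.prod_Icc_succ_top (by omega), mul_div_cancel_left₀ _ hn]

/-- The factors of a product with nonzero limit tend to one, and `p+0 * p0+ ≤ p0+ ≤ 1`. -/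
lemma tendsto_p0plus (hprod : ∃ a : ℝ, a ≠ 0 ∧
      Tendsto (fun n : ℕ => ∏ j ∈ Finset.Icc 1 n, (p j).pplus0 * (p j).p0plus) atTop (𝓝 a)) :
    Tendsto (fun n => (p n).p0plus) atTop (𝓝 1) := by
  obtain ⟨a, ha, h⟩ := hprod
  refine tendsto_of_tendsto_of_tendsto_of_le_of_le (tendsto_one_of_tendsto_prod_Icc ha h)
    tendsto_const_nhds (fun n => ?_) fun n => (p n).p0plus_le_one
  exact mul_le_of_le_one_left (p n).p0plus_nonneg (p n).pplus0_le_one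

/-- The ratio of successive terms is `p1+/p0+ = (1 - p0+)/p0+`, which tends to zero. -/
lemma summable_inv_prod_mean (h : Tendsto (fun n => (p n).p0plus) atTop (𝓝 1))
    (hpos : ∀ n, 0 < (p n).p0plus) (hpos' : ∀ n, 0 < (p n).p1plus) :
    Summable fun n => (∏ i ∈ Finset.range n, (p i).p0plus / (p i).p1plus)⁻¹ := by
  have hM : ∀ n, 0 < ∏ i ∈ Finset.range n, (p i).p0plus / (p i).p1plus := fun n =>
    Finset.prod_pos fun i _ => div_pos (hpos i) (hpos' i)
  have h1 : Tendsto (fun n => (1 - (p n).p0plus) / (p n).p0plus) atTop (𝓝 0) := by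
    simpa using! ((tendsto_const_nhds (x := (1 : ℝ))).sub h).div h one_ne_zero
  refine summable_of_ratio_test_tendsto_lt_one zero_lt_one
    (Eventually.of_forall fun n => inv_ne_zero (hM n).ne') (h1.congr fun n => ?_)
  rw [Real.norm_of_nonneg (inv_nonneg.2 (hM _).le), Real.norm_of_nonneg (inv_nonneg.2 (hM _).le),
    Finset.prod_range_succ, mul_inv, mul_div_cancel_left₀ _ (inv_ne_zero (hM n).ne'), inv_div,
    ← (p n).p0plus_add_p1plus, add_sub_cancel_left]

lemma exists_prod_mean_le (h : Tendsto (fun n => (p n).p0plus) atTop (𝓝 1))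
    (hsum : Summable fun n => (p n).pplus1) (hpos : ∀ n, 0 < (p n).p00)
    (hpos' : ∀ n, 0 < (p n).p1plus) :
    ∃ C : ℝ, ∀ n, ∏ i ∈ Finset.range n, (p i).p0plus / (p i).p1plus ≤
      C * ∏ i ∈ Finset.range n, (p i).p00 / (p i).p1plus := by
  have hs : Summable fun n => (p n).p01 / (p n).p00 := by
    have hlim : Tendsto (fun n => (p n).p0plus - (p n).pplus1) atTop (𝓝 1) := by
      simpa using h.sub hsum.tendsto_atTop_zero
    -- Eventually `p00 - p11 = p0+ - p+1 > 1/2`, so `p00 > 1/2` and `p01/p00 ≤ 2 * p01 ≤ 2 * p+1`.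
    refine (hsum.mul_left 2).of_norm_bounded_eventually_nat ?_
    filter_upwards [hlim.eventually (lt_mem_nhds (by norm_num : (1 / 2 : ℝ) < 1))] with n hn
    have h01 := (p n).p01_nonneg
    have h11 := (p n).p11_nonneg
    rw [Real.norm_of_nonneg (div_nonneg h01 (hpos n).le), div_le_iff₀ (hpos n)]
    simp only [BernoulliPair.p0plus, BernoulliPair.pplus1] at hn ⊢
    nlinarith
  refine ⟨Real.exp (∑' n, (p n).p01 / (p n).p00), fun n => ?_⟩
  calc ∏ i ∈ Finset.range n, (p i).p0plus / (p i).p1plus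
      ≤ ∏ i ∈ Finset.range n,
          Real.exp ((p i).p01 / (p i).p00) * ((p i).p00 / (p i).p1plus) := by
        refine Finset.prod_le_prod
          (fun i _ => div_nonneg (p i).p0plus_nonneg (hpos' i).le) fun i _ => ?_
        have e : (p i).p0plus / (p i).p1plus =
            ((p i).p01 / (p i).p00 + 1) * ((p i).p00 / (p i).p1plus) := by
          have := (hpos i).ne'
          have := (hpos' i).ne'
          rw [BernoulliPair.p0plus]
          field_simp
          ring
        rw [e]
        exact mul_le_mul_of_nonneg_right (Real.add_one_le_exp _)
          (div_nonneg (hpos i).le (hpos' i).le)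
    _ ≤ _ := by
        rw [Finset.prod_mul_distrib, ← Real.exp_sum]
        refine mul_le_mul_of_nonneg_right (Real.exp_le_exp.2 ?_)
          (Finset.prod_nonneg fun i _ => div_nonneg (hpos i).le (hpos' i).le)
        exact hs.sum_le_tsum _ fun i _ => div_nonneg (p i).p01_nonneg (hpos i).le

end Environment

/-! ### Moment bounds and submartingale property of the process -/

namespace IsGeometricEnvironment

variable {Ω : Type*} [mΩ : MeasurableSpace Ω] {P : Measure Ω}
  {p : ℕ → BernoulliPair} {ξ η : ℕ → ℕ → Ω → ℕ}

lemma measurable_process (h : IsGeometricEnvironment P p ξ η) (L : ℕ → ℕ → ℕ) (N n : ℕ) :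
    Measurable (bisexualProcess L N ξ η n) :=
  (measurable_bisexualProcess L N n).mono (h.generationSigma_le _) le_rfl

variable [IsProbabilityMeasure P]

lemma lintegral_process_le (h : IsGeometricEnvironment P p ξ η) (N n : ℕ) :
    ∫⁻ ω, (bisexualProcess promiscuous N ξ η n ω : ℝ≥0∞) ∂P ≤
      ENNReal.ofReal (N * ∏ i ∈ Finset.range n, (p i).p0plus / (p i).p1plus) := by
  induction n with
  | zero => simp [bisexualProcess]
  | succ n ih =>
    have hs := h.setLIntegral_bisexualProcess_succ promiscuous N n MeasurableSet.univ
      (fun k => (k : ℝ≥0∞))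
    simp only [setLIntegral_univ] at hs
    rw [hs]
    refine (lintegral_mono fun ω => h.lintegral_promiscuous_le n _).trans ?_
    rw [lintegral_mul_const _ (measurable_nat_cast_ennreal (h.measurable_process promiscuous N n)),
      Finset.prod_range_succ, ← mul_assoc,
      ENNReal.ofReal_mul' (div_nonneg (p n).p0plus_nonneg (p n).p1plus_nonneg)]
    gcongr

/-- The bound solves the recursion for second moments exactly: the new contribution `N * M_k * (m_k²
+ m_k)`, divided by `M_{k+1}²`, is `N/M_k + N/M_{k+1}`. -/
lemma lintegral_process_sq_le (h : IsGeometricEnvironment P p ξ η) (hpos : ∀ n, 0 < (p n).p0plus)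
    (N n : ℕ) :
    ∫⁻ ω, (bisexualProcess promiscuous N ξ η n ω : ℝ≥0∞) ^ 2 ∂P ≤
      ENNReal.ofReal ((∏ i ∈ Finset.range n, (p i).p0plus / (p i).p1plus) ^ 2 *
        (N ^ 2 + ∑ k ∈ Finset.range n,
          (N * (∏ i ∈ Finset.range k, (p i).p0plus / (p i).p1plus)⁻¹ +
            N * (∏ i ∈ Finset.range (k + 1), (p i).p0plus / (p i).p1plus)⁻¹))) := by
  have hm : ∀ i, 0 < (p i).p0plus / (p i).p1plus := fun i =>
    div_pos (hpos i) (h.1 i 0).p1plus_pos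
  have hM : ∀ n, 0 < ∏ i ∈ Finset.range n, (p i).p0plus / (p i).p1plus := fun n =>
    Finset.prod_pos fun i _ => hm i
  induction n with
  | zero => simp [bisexualProcess]
  | succ n ih =>
    have hs := h.setLIntegral_bisexualProcess_succ promiscuous N n MeasurableSet.univ
      (fun k => (k : ℝ≥0∞) ^ 2)
    simp only [setLIntegral_univ] at hs
    rw [hs]
    refine (lintegral_mono fun ω => h.lintegral_promiscuous_sq_le n _).trans ?_
    have hZ := measurable_nat_cast_ennreal (h.measurable_process promiscuous N n)
    rw [lintegral_add_left ((hZ.pow_const 2).mul_const _), lintegral_mul_const _ (hZ.pow_const 2),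
      lintegral_mul_const _ hZ]
    have hm0 := hm n
    have hM0 := hM n
    refine (add_le_add (mul_le_mul_left ih _)
      (mul_le_mul_left (h.lintegral_process_le N n) _)).trans ?_
    have hS : 0 ≤ ∑ k ∈ Finset.range n,
        ((N : ℝ) * (∏ i ∈ Finset.range k, (p i).p0plus / (p i).p1plus)⁻¹ +
          N * (∏ i ∈ Finset.range (k + 1), (p i).p0plus / (p i).p1plus)⁻¹) :=
      Finset.sum_nonneg fun k _ => add_nonneg
        (mul_nonneg N.cast_nonneg (inv_nonneg.2 (hM k).le))
        (mul_nonneg N.cast_nonneg (inv_nonneg.2 (hM (k + 1)).le))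
    rw [Finset.sum_range_succ, Finset.prod_range_succ]
    generalize ∑ k ∈ Finset.range n,
        ((N : ℝ) * (∏ i ∈ Finset.range k, (p i).p0plus / (p i).p1plus)⁻¹ +
          N * (∏ i ∈ Finset.range (k + 1), (p i).p0plus / (p i).p1plus)⁻¹) = S at *
    generalize ∏ i ∈ Finset.range n, (p i).p0plus / (p i).p1plus = M at *
    generalize (p n).p0plus / (p n).p1plus = m at *
    rw [← ENNReal.ofReal_pow hm0.le, ← ENNReal.ofReal_mul (by positivity),
      ← ENNReal.ofReal_mul (by positivity), ← ENNReal.ofReal_add (by positivity) (by positivity)]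
    refine ENNReal.ofReal_le_ofReal (le_of_eq ?_)
    field_simp
    ring

lemma le_setLIntegral_process_succ (h : IsGeometricEnvironment P p ξ η) (N n : ℕ) {A : Set Ω}
    (hA : MeasurableSet[generationSigma ξ η (Set.Iio n)] A) :
    (∫⁻ ω in A, (bisexualProcess promiscuous N ξ η n ω : ℝ≥0∞) ∂P) *
        ENNReal.ofReal ((p n).p00 / (p n).p1plus) ≤
      ∫⁻ ω in A, (bisexualProcess promiscuous N ξ η (n + 1) ω : ℝ≥0∞) ∂P := by
  rw [h.setLIntegral_bisexualProcess_succ promiscuous N n hA (fun k => (k : ℝ≥0∞)),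
    ← lintegral_mul_const _
      (measurable_nat_cast_ennreal (h.measurable_process promiscuous N n))]
  exact lintegral_mono fun ω => h.le_lintegral_promiscuous n _

lemma integrable_process (h : IsGeometricEnvironment P p ξ η) (N n : ℕ) :
    Integrable (fun ω => (bisexualProcess promiscuous N ξ η n ω : ℝ)) P := by
  refine ⟨((measurable_of_countable fun k : ℕ => (k : ℝ)).comp
    (h.measurable_process promiscuous N n)).aestronglyMeasurable, ?_⟩
  rw [hasFiniteIntegral_iff_ofReal (ae_of_all _ fun ω => Nat.cast_nonneg _)]
  simp only [ENNReal.ofReal_natCast]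
  exact (h.lintegral_process_le N n).trans_lt ENNReal.ofReal_lt_top

lemma setIntegral_process (h : IsGeometricEnvironment P p ξ η) (N n : ℕ) (A : Set Ω) :
    ∫ ω in A, (bisexualProcess promiscuous N ξ η n ω : ℝ) ∂P =
      (∫⁻ ω in A, (bisexualProcess promiscuous N ξ η n ω : ℝ≥0∞) ∂P).toReal := by
  rw [integral_eq_lintegral_of_nonneg_ae (ae_of_all _ fun ω => Nat.cast_nonneg _)
    (h.integrable_process N n).aestronglyMeasurable.restrict]
  simp only [ENNReal.ofReal_natCast]

lemma integrable_process_sq (h : IsGeometricEnvironment P p ξ η) (hpos : ∀ n, 0 < (p n).p0plus)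
    (N n : ℕ) : Integrable (fun ω => (bisexualProcess promiscuous N ξ η n ω : ℝ) ^ 2) P := by
  refine ⟨(h.integrable_process N n).aestronglyMeasurable.pow 2, ?_⟩
  rw [hasFiniteIntegral_iff_ofReal (ae_of_all _ fun ω => by positivity)]
  simp only [ENNReal.ofReal_pow (Nat.cast_nonneg _), ENNReal.ofReal_natCast]
  exact (h.lintegral_process_sq_le hpos N n).trans_lt ENNReal.ofReal_lt_top

lemma exists_integral_process_sq_le (h : IsGeometricEnvironment P p ξ η)
    (hpos : ∀ n, 0 < (p n).p0plus) (hlim : Tendsto (fun n => (p n).p0plus) atTop (𝓝 1)) (N : ℕ) :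
    ∃ C : ℝ, 0 ≤ C ∧ ∀ n, ∫ ω, (bisexualProcess promiscuous N ξ η n ω : ℝ) ^ 2 ∂P ≤
      C * (∏ i ∈ Finset.range n, (p i).p0plus / (p i).p1plus) ^ 2 := by
  have hpos' : ∀ n, 0 < (p n).p1plus := fun n => (h.1 n 0).p1plus_pos
  have hM : ∀ n, 0 < ∏ i ∈ Finset.range n, (p i).p0plus / (p i).p1plus := fun n =>
    Finset.prod_pos fun i _ => div_pos (hpos i) (hpos' i)
  have hsum := summable_inv_prod_mean hlim hpos hpos'
  have hsum' := (hsum.mul_left (N : ℝ)).add (((summable_nat_add_iff 1).2 hsum).mul_left (N : ℝ))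
  have hnn : ∀ k, 0 ≤ N * (∏ i ∈ Finset.range k, (p i).p0plus / (p i).p1plus)⁻¹ +
      N * (∏ i ∈ Finset.range (k + 1), (p i).p0plus / (p i).p1plus)⁻¹ := fun k =>
    add_nonneg (mul_nonneg N.cast_nonneg (inv_nonneg.2 (hM k).le))
        (mul_nonneg N.cast_nonneg (inv_nonneg.2 (hM (k + 1)).le))
  -- The witness, read off from the proof of its nonnegativity, is `N²` plus the full series.
  refine ⟨_, add_nonneg (sq_nonneg (N : ℝ)) (tsum_nonneg (L := .unconditional ℕ) hnn), fun n => ?_⟩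
  rw [integral_eq_lintegral_of_nonneg_ae (ae_of_all _ fun ω => by positivity)
    (h.integrable_process_sq hpos N n).aestronglyMeasurable]
  simp only [ENNReal.ofReal_pow (Nat.cast_nonneg _), ENNReal.ofReal_natCast]
  refine ENNReal.toReal_le_of_le_ofReal
    (mul_nonneg (add_nonneg (sq_nonneg (N : ℝ)) (tsum_nonneg hnn)) (sq_nonneg _))
    ((h.lintegral_process_sq_le hpos N n).trans (ENNReal.ofReal_le_ofReal ?_))
  rw [mul_comm]
  gcongr
  exact hsum'.sum_le_tsum _ fun k _ => hnn k

lemma normalization_eq (h : IsGeometricEnvironment P p ξ η) (n : ℕ) :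
    normalization P promiscuous ξ η n = ∏ i ∈ Finset.range n, (p i).p00 / (p i).p1plus :=
  Finset.prod_congr rfl fun i _ => h.meanGrowthRate_one i

lemma submartingale_process_div (h : IsGeometricEnvironment P p ξ η) (hpos : ∀ n, 0 < (p n).p00)
    (N : ℕ) :
    Submartingale (fun n ω => (bisexualProcess promiscuous N ξ η n ω : ℝ) /
      normalization P promiscuous ξ η n) h.pastFiltration P := by
  have hr : ∀ n, 0 < (p n).p00 / (p n).p1plus := fun n =>
    div_pos (hpos n) (h.1 n 0).p1plus_pos
  refine submartingale_of_setIntegral_le_succ (fun n => ?_)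
    (fun n => (h.integrable_process N n).div_const _) fun n A hA => ?_
  · exact (((measurable_of_countable fun k : ℕ => (k : ℝ)).comp
      (measurable_bisexualProcess promiscuous N n)).div_const _).stronglyMeasurable
  · have hle := ENNReal.toReal_mono ?_ (h.le_setLIntegral_process_succ N n hA)
    · rw [ENNReal.toReal_mul, ENNReal.toReal_ofReal (hr n).le] at hle
      have hμ : 0 < ∏ i ∈ Finset.range n, (p i).p00 / (p i).p1plus :=
        Finset.prod_pos fun i _ => hr i
      rw [integral_div, integral_div, h.setIntegral_process, h.setIntegral_process,
        h.normalization_eq, h.normalization_eq, Finset.prod_range_succ, div_le_div_iff₀ hμ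
        (mul_pos hμ (hr n))]
      nlinarith
    · exact ((setLIntegral_le_lintegral _ _).trans_lt ((h.lintegral_process_le N (n + 1)).trans_lt
        ENNReal.ofReal_lt_top)).ne

end IsGeometricEnvironment

/-! ### The limit theorem -/

theorem theorem11 {Ω : Type*} [MeasurableSpace Ω] (P : Measure Ω) [IsProbabilityMeasure P]
    (p : ℕ → BernoulliPair) (ξ η : ℕ → ℕ → Ω → ℕ) (henv : IsGeometricEnvironment P p ξ η)
    (N : ℕ) (hN : 0 < N)
    (hμ : ∀ n : ℕ, normalization P promiscuous ξ η n ≠ 0)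
    (hprod : ∃ a : ℝ, a ≠ 0 ∧
      Tendsto (fun n : ℕ => ∏ j ∈ Finset.Icc 1 n, (p j).pplus0 * (p j).p0plus) atTop (𝓝 a))
    (hsum : Summable (fun n : ℕ => (p n).pplus1)) :
    ∃ W : Ω → ℝ, Measurable W ∧ (∀ ω, 0 ≤ W ω) ∧
      (∀ᵐ ω ∂P, Tendsto
        (fun n : ℕ => (bisexualProcess promiscuous N ξ η n ω : ℝ) /
          normalization P promiscuous ξ η n) atTop (𝓝 (W ω))) ∧
      Integrable W P ∧ 0 < P {ω | 0 < W ω} := by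
  have hpos' : ∀ n, 0 < (p n).p1plus := fun n => (henv.1 n 0).p1plus_pos
  have hpos : ∀ n, 0 < (p n).p00 := by
    intro n
    -- If `p00(n)` were zero, then so would be the factor `r_{n1}` of `μ_{n+1}`.
    refine (p n).p00_nonneg.lt_of_ne' fun h0 => hμ (n + 1) ?_
    rw [henv.normalization_eq, Finset.prod_range_succ, h0, zero_div, mul_zero]
  have hpos0 : ∀ n, 0 < (p n).p0plus := fun n => add_pos_of_pos_of_nonneg (hpos n) (p n).p01_nonneg
  have hμpos : ∀ n, 0 < normalization P promiscuous ξ η n := fun n => by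
    rw [henv.normalization_eq]
    exact Finset.prod_pos fun i _ => div_pos (hpos i) (hpos' i)
  have hlim := tendsto_p0plus hprod
  obtain ⟨C, hC0, hC⟩ := henv.exists_integral_process_sq_le hpos0 hlim N
  obtain ⟨D, hD⟩ := exists_prod_mean_le hlim hsum hpos hpos'
  -- `E Z_n² ≤ C M_n²` and `M_n ≤ D μ_n`.
  refine exists_limit_of_submartingale_of_sq_bounded (C := C * D ^ 2)
    (henv.submartingale_process_div hpos N)
    (fun n ω => div_nonneg (Nat.cast_nonneg _) (hμpos n).le) (fun n => ?_) (fun n => ?_) ?_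
  · simp only [div_pow]
    exact (henv.integrable_process_sq hpos0 N n).div_const _
  · simp only [div_pow]
    rw [integral_div, div_le_iff₀ (pow_pos (hμpos n) 2)]
    refine (hC n).trans ?_
    have hM : 0 ≤ ∏ i ∈ Finset.range n, (p i).p0plus / (p i).p1plus :=
      Finset.prod_nonneg fun i _ => div_nonneg (hpos0 i).le (hpos' i).le
    rw [mul_assoc, ← mul_pow, henv.normalization_eq]
    gcongr
    exact hD n
  · simpa [bisexualProcess, normalization] using hN
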